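/- Work in the category $\mathbf{Loc}$ of locales, the opposite of the category of frames; for a morphism $f : X \to Y$ write $f^* : \mathcal{O}Y \to \mathcal{O}X$ for its frame homomorphism. The morphism $f$ is open if $f^*$ has a left adjoint $f_!$ with $f_!(f^*(u)\wedge v) = u \wedge f_!(v)$; it is an open surjection if it is open and an epimorphism; it is a local homeomorphism if both $f$ and its diagonal $X \to X\times_Y X$ are open. For a local homeomorphism $r : Y \to U$ with diagonal $\Delta : Y \to Y\times_U Y$ and projections $\pi_1,\pi_2 : Y\times_U Y \to Y$, a partial surjection over $U$ from $\mathbb{N}$ onto $Y$ is a family of opens $[f(n)=y] = F_n \in \mathcal{O}Y$, $n\in\mathbb{N}$ (that is, an open of $\mathbb{N}\times Y$, the graph), such that \[ \pi_1^*(F_n)\wedge \pi_2^*(F_n) \le \Delta_!(\top) \ \text{ for all } n\in\mathbb{N} \quad\text{(functionality)}, \qquad \bigvee_{n\in\mathbb{N}} F_n = \top \quad\text{(surjectivity)}. \] Let $p : X \to H$ be a local homeomorphism of locales. Then there are a locale $[\mathbb{N}\rightharpoondown_H X]$ and an open surjection $q : [\mathbb{N}\rightharpoondown_H X] \to H$ such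 that, for every locale $U$, the generalised points $t : U \to [\mathbb{N}\rightharpoondown_H X]$ are in bijection with the pairs consisting of a generalised point $h : U \to H$ and a partial surjection over $U$ from $\mathbb{N}$ onto the fibre $p^{-1}(h)$, the pullback $U\times_H X \to U$ of $p$ along $h$. The bijection is natural in $U$ (precomposition with $g : V \to U$ corresponds to pulling $h$ and the graph back along $g$), and the first component of the pair corresponding to $t$ is $h = q\circ t$. -/

import Mathlib

open CategoryTheory CategoryTheory.Limits

universe u

namespace Locale

/-- The frame homomorphism `f^* : O Y → O X` of a locale morphism `f : X ⟶ Y`. -/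
def inv {X Y : Locale.{u}} (f : X ⟶ Y) : FrameHom Y X :=
  Frm.Hom.hom (Quiver.Hom.unop f)

/-- The locale morphism with a given inverse image frame homomorphism. -/
def ofInv {X Y : Locale.{u}} (φ : FrameHom Y X) : X ⟶ Y :=
  Quiver.Hom.op (Frm.ofHom φ)

@[simp] theorem inv_ofInv {X Y : Locale.{u}} (φ : FrameHom Y X) : inv (ofInv φ) = φ := rfl

@[simp] theorem ofInv_inv {X Y : Locale.{u}} (f : X ⟶ Y) : ofInv (inv f) = f := rfl

@[simp] theorem inv_comp {X Y Z : Locale.{u}} (f : X ⟶ Y) (g : Y ⟶ Z) :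
    inv (f ≫ g) = (inv f).comp (inv g) := rfl

@[simp] theorem inv_id (X : Locale.{u}) : inv (𝟙 X) = FrameHom.id X := rfl

theorem hom_ext {X Y : Locale.{u}} {f g : X ⟶ Y} (h : ∀ v, inv f v = inv g v) : f = g := by
  rw [← ofInv_inv f, ← ofInv_inv g]
  exact congrArg ofInv (FrameHom.ext h)

/-! ### Pullbacks of locales

The frame of a pullback is the pushout of frames `B ⊗_A C`, realised as the frame of those lower
sets of `B × C` that are closed under joins in each variable and balanced over `A`. -/

section Pushout

variable {A B C : Type u} [Order.Frame A] [Order.Frame B] [Order.Frame C]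

theorem mem_himp_lowerSet (E D : LowerSet (B × C)) (x : B × C) :
    x ∈ E ⇨ D ↔ ∀ y ≤ x, y ∈ E → y ∈ D := by
  rw [← LowerSet.Iic_le, le_himp_iff]
  constructor
  · intro h y hy hE
    exact h (show y ∈ LowerSet.Iic x ⊓ E from ⟨hy, hE⟩)
  · rintro h y ⟨hy, hE⟩
    exact h y hy hE

/-- The pushout of frames `B ⊗_A C`. -/
def pushoutFrame (f : FrameHom A B) (g : FrameHom A C) : Sublocale (LowerSet (B × C)) where
  carrier := {D |
    (∀ (S : Set B) (c : C), (∀ b ∈ S, (b, c) ∈ D) → (sSup S, c) ∈ D) ∧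
    (∀ (b : B) (S : Set C), (∀ c ∈ S, (b, c) ∈ D) → (b, sSup S) ∈ D) ∧
    (∀ (a : A) (b : B) (c : C), (b ⊓ f a, c) ∈ D ↔ (b, c ⊓ g a) ∈ D)}
  sInf_mem' := by
    intro s hs
    refine ⟨fun S c h => ?_, fun b S h => ?_, fun a b c => ?_⟩
    · rw [LowerSet.mem_sInf_iff]
      intro D hD
      exact (hs hD).1 S c fun b hb => LowerSet.mem_sInf_iff.1 (h b hb) D hD
    · rw [LowerSet.mem_sInf_iff]
      intro D hD
      exact (hs hD).2.1 b S fun c hc => LowerSet.mem_sInf_iff.1 (h c hc) D hD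
    · rw [LowerSet.mem_sInf_iff, LowerSet.mem_sInf_iff]
      exact forall₂_congr fun D hD => (hs hD).2.2 a b c
  himp_mem' := by
    rintro E D ⟨h₁, h₂, h₃⟩
    refine ⟨fun S c h => ?_, fun b S h => ?_, fun a b c => ?_⟩
    · rw [mem_himp_lowerSet]
      rintro ⟨b', c'⟩ ⟨hb, hc⟩ hE
      have key := h₁ ((fun s => b' ⊓ s) '' S) c' (by
        rintro _ ⟨s, hs, rfl⟩
        exact (mem_himp_lowerSet E D _).1 (h s hs) _ ⟨inf_le_right, hc⟩
          (E.lower (show ((b' ⊓ s, c') : B × C) ≤ (b', c') from ⟨inf_le_left, le_rfl⟩) hE))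
      rw [sSup_image, ← inf_sSup_eq] at key
      rwa [inf_eq_left.2 hb] at key
    · rw [mem_himp_lowerSet]
      rintro ⟨b', c'⟩ ⟨hb, hc⟩ hE
      have key := h₂ b' ((fun s => c' ⊓ s) '' S) (by
        rintro _ ⟨s, hs, rfl⟩
        exact (mem_himp_lowerSet E D _).1 (h s hs) _ ⟨hb, inf_le_right⟩
          (E.lower (show ((b', c' ⊓ s) : B × C) ≤ (b', c') from ⟨le_rfl, inf_le_left⟩) hE))
      rw [sSup_image, ← inf_sSup_eq] at key
      rwa [inf_eq_left.2 hc] at key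
    · rw [mem_himp_lowerSet, mem_himp_lowerSet]
      constructor
      · rintro h ⟨b', c'⟩ ⟨hb, hc⟩ hE
        have hc' : c' ≤ c ⊓ g a := hc
        have := (h₃ a b' c').1 (h (b' ⊓ f a, c')
          ⟨inf_le_inf_right _ hb, hc'.trans inf_le_left⟩
          (E.lower (show ((b' ⊓ f a, c') : B × C) ≤ (b', c') from ⟨inf_le_left, le_rfl⟩) hE))
        rwa [inf_eq_left.2 (hc'.trans inf_le_right)] at this
      · rintro h ⟨b', c'⟩ ⟨hb, hc⟩ hE
        have hb' : b' ≤ b ⊓ f a := hb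
        have := (h₃ a b' c').2 (h (b', c' ⊓ g a)
          ⟨hb'.trans inf_le_left, inf_le_inf_right _ hc⟩
          (E.lower (show ((b', c' ⊓ g a) : B × C) ≤ (b', c') from ⟨le_rfl, inf_le_left⟩) hE))
        rwa [inf_eq_left.2 (hb'.trans inf_le_right)] at this

variable (f : FrameHom A B) (g : FrameHom A C)

/-- The pure tensor `b ⊗ c`. -/
def pushoutTmul (b : B) (c : C) : pushoutFrame f g :=
  (pushoutFrame f g).restrict (LowerSet.Iic (b, c))

theorem pushoutTmul_le_iff (b : B) (c : C) (D : pushoutFrame f g) :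
    pushoutTmul f g b c ≤ D ↔ (b, c) ∈ (D : LowerSet (B × C)) := by
  rw [pushoutTmul, (pushoutFrame f g).giRestrict.gc _ _, LowerSet.Iic_le]

theorem pushoutTmul_inf (b b' : B) (c c' : C) :
    pushoutTmul f g b c ⊓ pushoutTmul f g b' c' = pushoutTmul f g (b ⊓ b') (c ⊓ c') := by
  rw [pushoutTmul, pushoutTmul, ← map_inf, pushoutTmul]
  congr 1
  ext ⟨x, y⟩
  simp

/-- The coprojection `b ↦ b ⊗ ⊤`. -/
def pushoutInl : FrameHom B (pushoutFrame f g) where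
  toFun b := pushoutTmul f g b ⊤
  map_inf' b b' := by rw [pushoutTmul_inf, inf_idem]
  map_top' := top_unique ((pushoutFrame f g).restrict.map_top' ▸
    OrderHomClass.mono (pushoutFrame f g).restrict (by
      intro x _
      exact (le_top : x ≤ (⊤, ⊤))))
  map_sSup' S := by
    apply le_antisymm
    · rw [pushoutTmul_le_iff]
      refine (sSup ((fun b => pushoutTmul f g b ⊤) '' S)).2.1 S ⊤ fun b hb => ?_
      rw [← pushoutTmul_le_iff]
      exact le_sSup ⟨b, hb, rfl⟩
    · refine sSup_le ?_
      rintro _ ⟨b, hb, rfl⟩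
      exact OrderHomClass.mono (pushoutFrame f g).restrict (LowerSet.Iic_le.2 ⟨le_sSup hb, le_rfl⟩)

/-- The coprojection `c ↦ ⊤ ⊗ c`. -/
def pushoutInr : FrameHom C (pushoutFrame f g) where
  toFun c := pushoutTmul f g ⊤ c
  map_inf' c c' := by rw [pushoutTmul_inf, inf_idem]
  map_top' := (pushoutInl f g).map_top'
  map_sSup' S := by
    apply le_antisymm
    · rw [pushoutTmul_le_iff]
      refine (sSup ((fun c => pushoutTmul f g ⊤ c) '' S)).2.2.1 ⊤ S fun c hc => ?_
      rw [← pushoutTmul_le_iff]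
      exact le_sSup ⟨c, hc, rfl⟩
    · refine sSup_le ?_
      rintro _ ⟨c, hc, rfl⟩
      exact OrderHomClass.mono (pushoutFrame f g).restrict (LowerSet.Iic_le.2 ⟨le_rfl, le_sSup hc⟩)

theorem pushoutInl_inf_inr (b : B) (c : C) :
    pushoutInl f g b ⊓ pushoutInr f g c = pushoutTmul f g b c := by
  change pushoutTmul f g b ⊤ ⊓ pushoutTmul f g ⊤ c = _
  rw [pushoutTmul_inf, inf_top_eq, top_inf_eq]

theorem pushout_condition (a : A) : pushoutInl f g (f a) = pushoutInr f g (g a) := by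
  change pushoutTmul f g (f a) ⊤ = pushoutTmul f g ⊤ (g a)
  apply le_antisymm
  · rw [pushoutTmul_le_iff]
    have := ((pushoutTmul f g ⊤ (g a)).2.2.2 a ⊤ ⊤).2
    rw [top_inf_eq, top_inf_eq] at this
    exact this ((pushoutTmul_le_iff f g _ _ _).1 le_rfl)
  · rw [pushoutTmul_le_iff]
    have := ((pushoutTmul f g (f a) ⊤).2.2.2 a ⊤ ⊤).1
    rw [top_inf_eq, top_inf_eq] at this
    exact this ((pushoutTmul_le_iff f g _ _ _).1 le_rfl)

theorem pushout_eq_sSup (D : pushoutFrame f g) :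
    D = sSup ((fun x : B × C => pushoutTmul f g x.1 x.2) '' {x | x ∈ (D : LowerSet (B × C))}) := by
  apply le_antisymm
  · intro x hx
    exact (pushoutTmul_le_iff f g x.1 x.2 _).1 (le_sSup ⟨x, hx, rfl⟩)
  · refine sSup_le ?_
    rintro _ ⟨x, hx, rfl⟩
    exact (pushoutTmul_le_iff f g _ _ _).2 hx

variable {Z : Type u} [Order.Frame Z] (h : FrameHom B Z) (k : FrameHom C Z)

/-- The value of the mediating homomorphism on an element of the pushout. -/
def pushoutDescFun (D : pushoutFrame f g) : Z :=
  sSup ((fun x : B × C => h x.1 ⊓ k x.2) '' {x | x ∈ (D : LowerSet (B × C))})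

theorem pushoutDesc_exists_adjoint (w : ∀ a, h (f a) = k (g a)) :
    ∃ r : Z → pushoutFrame f g, GaloisConnection (pushoutDescFun f g h k) r ∧
      ∀ z b c, (b, c) ∈ (r z : LowerSet (B × C)) ↔ h b ⊓ k c ≤ z := by
  refine ⟨fun z => ⟨⟨{x | h x.1 ⊓ k x.2 ≤ z}, ?_⟩, ?_, ?_, ?_⟩, ?_, fun z b c => Iff.rfl⟩
  · intro x y hyx hx
    exact (inf_le_inf (OrderHomClass.mono h hyx.1) (OrderHomClass.mono k hyx.2)).trans hx
  · intro S c hS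
    change h (sSup S) ⊓ k c ≤ z
    rw [map_sSup, sSup_inf_eq]
    refine iSup₂_le ?_
    rintro _ ⟨b, hb, rfl⟩
    exact hS b hb
  · intro b S hS
    change h b ⊓ k (sSup S) ≤ z
    rw [map_sSup, inf_sSup_eq]
    refine iSup₂_le ?_
    rintro _ ⟨c, hc, rfl⟩
    exact hS c hc
  · intro a b c
    change h (b ⊓ f a) ⊓ k c ≤ z ↔ h b ⊓ k (c ⊓ g a) ≤ z
    rw [map_inf, map_inf, w, inf_assoc, inf_comm (k (g a))]
  · intro D z
    constructor
    · intro hD x hx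
      have hle : h x.1 ⊓ k x.2 ≤ pushoutDescFun f g h k D := le_sSup ⟨x, hx, rfl⟩
      exact hle.trans hD
    · intro hD
      refine sSup_le ?_
      rintro _ ⟨x, hx, rfl⟩
      exact hD hx

/-- The mediating homomorphism out of the pushout. -/
def pushoutDesc (w : ∀ a, h (f a) = k (g a)) : FrameHom (pushoutFrame f g) Z where
  toFun := pushoutDescFun f g h k
  map_inf' D E := by
    obtain ⟨r, hr, -⟩ := pushoutDesc_exists_adjoint f g h k w
    apply le_antisymm
    · exact hr.monotone_l.map_inf_le D E
    · unfold pushoutDescFun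
      rw [sSup_inf_sSup]
      refine iSup₂_le ?_
      rintro ⟨_, _⟩ ⟨⟨x, hx, rfl⟩, ⟨y, hy, rfl⟩⟩
      have hxy : x ⊓ y ∈ ((D ⊓ E : pushoutFrame f g) : LowerSet (B × C)) :=
        ⟨LowerSet.lower _ (inf_le_left : x ⊓ y ≤ x) hx,
          LowerSet.lower _ (inf_le_right : x ⊓ y ≤ y) hy⟩
      have hval : h x.1 ⊓ k x.2 ⊓ (h y.1 ⊓ k y.2) = h (x.1 ⊓ y.1) ⊓ k (x.2 ⊓ y.2) := by
        rw [map_inf, map_inf, inf_inf_inf_comm]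
      exact hval.le.trans (le_sSup ⟨x ⊓ y, hxy, rfl⟩)
  map_top' := by
    refine top_unique (le_sSup ⟨(⊤, ⊤), ?_, ?_⟩)
    · exact (pushoutTmul_le_iff f g _ _ _).1 le_top
    · change h ⊤ ⊓ k ⊤ = ⊤
      rw [map_top, map_top, inf_top_eq]
  map_sSup' S := by
    obtain ⟨r, hr, -⟩ := pushoutDesc_exists_adjoint f g h k w
    rw [hr.l_sSup, sSup_image]

theorem pushoutDesc_tmul (w : ∀ a, h (f a) = k (g a)) (b : B) (c : C) :
    pushoutDesc f g h k w (pushoutTmul f g b c) = h b ⊓ k c := by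
  obtain ⟨r, hr, hm⟩ := pushoutDesc_exists_adjoint f g h k w
  refine eq_of_forall_ge_iff fun z => ?_
  change pushoutDescFun f g h k _ ≤ z ↔ _
  rw [hr _ _, pushoutTmul_le_iff, hm]

theorem pushoutDesc_inl (w : ∀ a, h (f a) = k (g a)) (b : B) :
    pushoutDesc f g h k w (pushoutInl f g b) = h b := by
  refine (pushoutDesc_tmul f g h k w b ⊤).trans ?_
  rw [map_top, inf_top_eq]

theorem pushoutDesc_inr (w : ∀ a, h (f a) = k (g a)) (c : C) :
    pushoutDesc f g h k w (pushoutInr f g c) = k c := by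
  refine (pushoutDesc_tmul f g h k w ⊤ c).trans ?_
  rw [map_top, top_inf_eq]

theorem pushout_hom_ext {m m' : FrameHom (pushoutFrame f g) Z}
    (h₁ : ∀ b, m (pushoutInl f g b) = m' (pushoutInl f g b))
    (h₂ : ∀ c, m (pushoutInr f g c) = m' (pushoutInr f g c)) : m = m' := by
  refine FrameHom.ext fun D => ?_
  rw [pushout_eq_sSup f g D, map_sSup, map_sSup, Set.image_image, Set.image_image]
  congr 1
  refine Set.image_congr fun x _ => ?_
  rw [← pushoutInl_inf_inr, map_inf, map_inf, h₁, h₂]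

end Pushout

/-- The pullback cone of locales given by the pushout of frames. -/
def pullbackConeOfFrames {X Y Z : Locale.{u}} (f : X ⟶ Z) (g : Y ⟶ Z) : PullbackCone f g :=
  PullbackCone.mk (W := Locale.of (pushoutFrame (inv f) (inv g)))
    (ofInv (X := Locale.of (pushoutFrame (inv f) (inv g))) (pushoutInl (inv f) (inv g)))
    (ofInv (X := Locale.of (pushoutFrame (inv f) (inv g))) (pushoutInr (inv f) (inv g)))
    (hom_ext fun a => pushout_condition (inv f) (inv g) a)

/-- The pullback cone given by the pushout of frames is a pullback. -/
def pullbackConeOfFramesIsLimit {X Y Z : Locale.{u}} (f : X ⟶ Z) (g : Y ⟶ Z) :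
    IsLimit (pullbackConeOfFrames f g) :=
  PullbackCone.IsLimit.mk _
    (fun s => ofInv (Y := Locale.of (pushoutFrame (inv f) (inv g)))
      (pushoutDesc (inv f) (inv g) (inv s.fst) (inv s.snd)
        fun a => congrArg (fun t => inv t a) s.condition))
    (fun s => hom_ext fun b => pushoutDesc_inl (inv f) (inv g) (inv s.fst) (inv s.snd)
      (fun a => congrArg (fun t => inv t a) s.condition) b)
    (fun s => hom_ext fun c => pushoutDesc_inr (inv f) (inv g) (inv s.fst) (inv s.snd)
      (fun a => congrArg (fun t => inv t a) s.condition) c)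
    (fun s m h₁ h₂ => congrArg ofInv (pushout_hom_ext (inv f) (inv g) (m := inv m)
      (fun b => (congrArg (fun t => inv t b) h₁).trans
        (pushoutDesc_inl (inv f) (inv g) (inv s.fst) (inv s.snd)
          (fun a => congrArg (fun t => inv t a) s.condition) b).symm)
      (fun c => (congrArg (fun t => inv t c) h₂).trans
        (pushoutDesc_inr (inv f) (inv g) (inv s.fst) (inv s.snd)
          (fun a => congrArg (fun t => inv t a) s.condition) c).symm)))

instance : HasPullbacks Locale.{u} :=
  haveI : ∀ {X Y Z : Locale.{u}} {f : X ⟶ Z} {g : Y ⟶ Z}, HasLimit (cospan f g) :=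
    fun {_ _ _ f g} => HasLimit.mk ⟨pullbackConeOfFrames f g, pullbackConeOfFramesIsLimit f g⟩
  hasPullbacks_of_hasLimit_cospan _

/-! ### Open maps and local homeomorphisms -/

/-- A locale morphism `f` is open if `f^*` has a left adjoint satisfying Frobenius reciprocity. -/
def IsOpenMap {X Y : Locale.{u}} (f : X ⟶ Y) : Prop :=
  ∃ l : X → Y, GaloisConnection l (inv f) ∧
    ∀ (u : Y) (v : X), l (inv f u ⊓ v) = u ⊓ l v

/-- An open surjection is an open epimorphism of locales. -/
def IsOpenSurjection {X Y : Locale.{u}} (f : X ⟶ Y) : Prop :=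
  IsOpenMap f ∧ Epi f

/-- A local homeomorphism is an open morphism with open diagonal. -/
def IsLocalHomeo {X Y : Locale.{u}} (f : X ⟶ Y) : Prop :=
  IsOpenMap f ∧ IsOpenMap (pullback.diagonal f)

/-- The equality predicate `⟦y = y'⟧` of a locale `Y` over `U`, as an open of `Y ×_U Y`: the least
open containing the diagonal `Δ`.  When `Δ` is open, this is `Δ_! ⊤`, the open sublocale
corresponding to the diagonal. -/
noncomputable def eqPred {Y U : Locale.{u}} (r : Y ⟶ U) : (pullback r r : Locale.{u}) :=
  sInf {d : (pullback r r : Locale.{u}) | inv (pullback.diagonal r) d = ⊤}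

theorem eqPred_eq {Y U : Locale.{u}} (r : Y ⟶ U) (l : Y → (pullback r r : Locale.{u}))
    (hl : GaloisConnection l (inv (pullback.diagonal r))) : eqPred r = l ⊤ := by
  refine le_antisymm (sInf_le (top_unique (hl.le_u_l ⊤))) (le_sInf fun d hd => ?_)
  exact (hl ⊤ d).2 (le_of_eq (Eq.symm hd))

/-! ### Partial surjections onto the fibres -/

/-- A partial surjection over `U` from the constant object `ℕ` onto `r : Y ⟶ U` (internally to
sheaves on `U`), given by its graph.  The graph is an open of `ℕ × Y`, that is, a family of opens
`[f(n) = y]` of `Y` indexed by `n : ℕ`, and it satisfies the two axioms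
`[f(n) = y] ∧ [f(n) = y'] ⊢ ⟦y = y'⟧` and `⊢ ⋁ n, [f(n) = y]`. -/
structure PartialSurjection {Y U : Locale.{u}} (r : Y ⟶ U) where
  graph : ℕ → Y
  functional : ∀ n, inv (pullback.fst r r) (graph n) ⊓ inv (pullback.snd r r) (graph n) ≤ eqPred r
  surjective : ⨆ n, graph n = ⊤

/-- A pair of a generalised point `h : U ⟶ H` of `H` and a partial surjection over `U` from `ℕ`
onto the fibre `p⁻¹(h)`, the pullback of `p` along `h`. -/
structure FibrePartialSurjection {X H : Locale.{u}} (p : X ⟶ H) (U : Locale.{u}) where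
  point : U ⟶ H
  partialSurjection : PartialSurjection (pullback.snd p point)

/-- The comparison `p⁻¹(h') ⟶ p⁻¹(h)` of fibres, over `g : V ⟶ U`, when `h' = g ≫ h`. -/
noncomputable def fibreMap {X H : Locale.{u}} (p : X ⟶ H) {U V : Locale.{u}} (g : V ⟶ U)
    {h : U ⟶ H} {h' : V ⟶ H} (w : h' = g ≫ h) : pullback p h' ⟶ pullback p h :=
  pullback.lift (pullback.fst p h') (pullback.snd p h' ≫ g)
    (by rw [Category.assoc, ← w, pullback.condition])

/-- `b` is the restriction (change of base) of `a` along `g : V ⟶ U`. -/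
def FibrePartialSurjection.IsRestriction {X H : Locale.{u}} {p : X ⟶ H} {U V : Locale.{u}}
    (g : V ⟶ U) (a : FibrePartialSurjection p U) (b : FibrePartialSurjection p V) : Prop :=
  ∃ w : b.point = g ≫ a.point, ∀ n,
    b.partialSurjection.graph n = inv (fibreMap p g w) (a.partialSurjection.graph n)

end Locale

/-!
Let `p : X ⟶ H` be a local homeomorphism and let `s` and `r` be the projections of `U ×_H X` to `X`
and `U`.  An open `F` of `U ×_H X` is determined by its incidence relation `u ↦ r_! (F ⊓ s^* u)`: it
is recovered over the sections of `p`, which cover `X`, and on which meeting an open is the same as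
lying in it.  The incidence relations are exactly the join-preserving maps `O X → O U` that are
linear over `O H`.  Functionality says that the incidence relation preserves binary meets, and
surjectivity that the join of the incidence relations is `h^* p_!`.  These are equations between
opens of `U`, preserved by inverse images, so they can be read as a presentation of a frame by
generators `⟦f n ∈ u⟧` and relations, over the frame of `H`.

The resulting locale maps openly onto `H` because the direct image of a basic open, given by an open
`c` of `H` and finitely many conditions `f n ∈ u n`, is `c ⊓ ⨅ n, p_! (u n)`.  This formula respects
the surjectivity relation because an index unused by the conditions always remains.
-/

namespace EnumerationLocale

open Locale hiding inv IsOpenMap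

/-- The inverse image `f^* v` of an open along a morphism of locales. -/
local postfix:max "^*" => Locale.inv

section JoinDense

variable {ι A B : Type*} {x : ι → B}

/-- A family is join-dense if every element is the join of the members of the family below it,
which is expressed without mentioning joins. -/
def IsJoinDense [Preorder B] (x : ι → B) : Prop :=
  ∀ ⦃b c⦄, (∀ i, x i ≤ b → x i ≤ c) → b ≤ c

theorem IsJoinDense.orderIso [Preorder A] [Preorder B] (hx : IsJoinDense x) (e : B ≃o A) :
    IsJoinDense fun i => e (x i) := fun _ _ h =>
  e.symm.le_iff_le.1 (hx fun i hi => (e.le_symm_apply).2 (h i (e.le_symm_apply.1 hi)))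

theorem IsJoinDense.iSup_eq [CompleteLattice B] (hx : IsJoinDense x) (b : B) :
    ⨆ i : {i // x i ≤ b}, x i = b :=
  le_antisymm (iSup_le fun i => i.2) <| hx fun i hi =>
    le_iSup (fun i : {i // x i ≤ b} => x i) ⟨i, hi⟩

theorem IsJoinDense.induction [CompleteLattice B] (hx : IsJoinDense x) {P : B → Prop}
    (mem : ∀ i, P (x i)) (sSup : ∀ S, (∀ b ∈ S, P b) → P (sSup S)) (b : B) : P b := by
  rw [← hx.iSup_eq b]
  exact sSup _ (Set.forall_mem_range.2 fun i => mem i)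

theorem IsJoinDense.inf_iSup_le_iff [Order.Frame A] [Order.Frame B] (hx : IsJoinDense x)
    {f : A → B} {φ : ι → A} (h : ∀ i a c, f a ⊓ x i ≤ f c ↔ a ⊓ φ i ≤ c) (a c : A) (b : B) :
    f a ⊓ b ≤ f c ↔ a ⊓ ⨆ i : {i // x i ≤ b}, φ i ≤ c := by
  simp only [inf_iSup_eq, iSup_le_iff, ← h, Subtype.forall]
  refine ⟨fun hb i hi => (inf_le_inf_left _ hi).trans hb, fun hb => ?_⟩
  rw [inf_comm, ← le_himp_iff]
  exact hx fun i hi => le_himp_iff.2 (by simpa only [inf_comm] using hb i hi)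

end JoinDense

section Presentation

variable {L : Type u} [SemilatticeInf L] [OrderTop L] {Z : Type u} [Order.Frame Z]

/-- The frame generated by the meet-semilattice `L` subject to the relations `x ≤ ⨆ s ∈ S, s`, one
for each cover `R x S`.  It consists of the lower sets that are closed under the pullbacks
`x ⊓ y ≤ ⨆ s ∈ S, s ⊓ y` of the covers. -/
def presentedFrame (R : L → Set L → Prop) : Sublocale (LowerSet L) where
  carrier := {D | ∀ ⦃x S⦄, R x S → ∀ y, (∀ s ∈ S, s ⊓ y ∈ D) → x ⊓ y ∈ D}
  sInf_mem' := by
    intro 𝒟 h𝒟 x S hR y hS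
    exact LowerSet.mem_sInf_iff.2 fun D hD =>
      h𝒟 hD hR y fun s hs => LowerSet.mem_sInf_iff.1 (hS s hs) D hD
  himp_mem' := by
    intro E D hD x S hR y hS
    rw [← LowerSet.Iic_le, le_himp_iff]
    rintro z ⟨hz : z ≤ x ⊓ y, hzE⟩
    rw [← inf_eq_right.2 (hz.trans inf_le_left)]
    refine hD hR z fun s hs => ?_
    have hsy : LowerSet.Iic (s ⊓ y) ⊓ E ≤ D := le_himp_iff.1 (LowerSet.Iic_le.2 (hS s hs))
    exact hsy ⟨le_inf inf_le_left (inf_le_right.trans (hz.trans inf_le_right)),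
      E.lower inf_le_right hzE⟩

variable (R : L → Set L → Prop)

/-- The inclusion of the generators into the presented frame. -/
def generator : InfTopHom L (presentedFrame R) where
  toFun x := (presentedFrame R).restrict (LowerSet.Iic x)
  map_inf' x y := by rw [LowerSet.Iic_inf, map_inf]
  map_top' := by rw [LowerSet.Iic_top, map_top]

variable {R}

theorem generator_le_iff {x : L} {D : presentedFrame R} :
    generator R x ≤ D ↔ x ∈ (D : LowerSet L) :=
  ((presentedFrame R).giRestrict.gc _ _).trans LowerSet.Iic_le

theorem isJoinDense_generator : IsJoinDense (generator R) := fun _ _ h x hx =>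
  generator_le_iff.1 (h x (generator_le_iff.2 hx))

theorem generator_le_iSup {x : L} {S : Set L} (hR : R x S) :
    generator R x ≤ ⨆ s ∈ S, generator R s := by
  rw [generator_le_iff, ← inf_top_eq x]
  refine (⨆ s ∈ S, generator R s).2 hR ⊤ fun s hs => ?_
  rw [inf_top_eq, ← generator_le_iff]
  exact le_iSup₂_of_le s hs le_rfl

theorem frameHom_ext {m m' : FrameHom (presentedFrame R) Z}
    (h : ∀ x, m (generator R x) = m' (generator R x)) : m = m' :=
  FrameHom.ext <| isJoinDense_generator.induction h fun S hS => by
    rw [map_sSup, map_sSup, Set.image_congr hS]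

/-- The elements at which a monotone function, compatible with the pullbacks of the covers, is at
most `z`, as an element of the presented frame. -/
def sublevel {φ : L → Z} (hφ : Monotone φ)
    (hR : ∀ ⦃x S⦄, R x S → ∀ y, φ (x ⊓ y) ≤ ⨆ s ∈ S, φ (s ⊓ y)) (z : Z) : presentedFrame R :=
  ⟨⟨{x | φ x ≤ z}, fun _ _ hyx hx => (hφ hyx).trans hx⟩,
    fun _ _ h y hS => (hR h y).trans (iSup₂_le hS)⟩

theorem generator_le_sublevel_iff {φ : L → Z} (hφ : Monotone φ)
    (hR : ∀ ⦃x S⦄, R x S → ∀ y, φ (x ⊓ y) ≤ ⨆ s ∈ S, φ (s ⊓ y)) {x : L} {z : Z} :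
    generator R x ≤ sublevel hφ hR z ↔ φ x ≤ z :=
  generator_le_iff

section Lift

variable (φ : InfTopHom L Z) (hφ : ∀ ⦃x S⦄, R x S → φ x ≤ ⨆ s ∈ S, φ s)

include hφ in
theorem map_inf_le_iSup_of_cover {x : L} {S : Set L} (hR : R x S) (y : L) :
    φ (x ⊓ y) ≤ ⨆ s ∈ S, φ (s ⊓ y) := by
  simp only [map_inf, ← iSup₂_inf_eq]
  exact inf_le_inf_right _ (hφ hR)

theorem lift_galoisConnection : GaloisConnection
    (fun D : presentedFrame R => ⨆ x : (D : LowerSet L), φ x)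
    (sublevel (OrderHomClass.mono φ) fun _ _ => map_inf_le_iSup_of_cover φ hφ) := fun _ _ =>
  iSup_le_iff.trans Subtype.forall

/-- The universal property of the presented frame: a meet-preserving map that respects the covers
extends to a frame homomorphism. -/
def lift : FrameHom (presentedFrame R) Z where
  toFun D := ⨆ x : (D : LowerSet L), φ x
  map_inf' D E := by
    refine le_antisymm ((lift_galoisConnection φ hφ).monotone_l.map_inf_le D E) ?_
    rw [iSup_inf_iSup]
    refine iSup_le fun x => ?_
    rw [← map_inf]
    exact le_iSup (fun x : ((D ⊓ E : presentedFrame R) : LowerSet L) => φ x) ⟨x.1 ⊓ x.2,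
      LowerSet.lower _ inf_le_left x.1.2, LowerSet.lower _ inf_le_right x.2.2⟩
  map_top' := top_unique <| (map_top φ).ge.trans <|
    le_iSup (fun x : ((⊤ : presentedFrame R) : LowerSet L) => φ x)
      ⟨⊤, generator_le_iff.1 le_top⟩
  map_sSup' S := by rw [(lift_galoisConnection φ hφ).l_sSup, sSup_image]

@[simp]
theorem lift_generator (x : L) : lift φ hφ (generator R x) = φ x :=
  eq_of_forall_ge_iff fun z =>
    (lift_galoisConnection φ hφ _ z).trans (generator_le_sublevel_iff _ _)

end Lift

end Presentation

section FiniteCondition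

variable {ι A B Z W : Type*}

/-- A finite conjunction of conditions, at most one for each index: a family in `WithTop B` whose
value is the added top, meaning that nothing is required, at all but finitely many indices.  (When
`B` has a top element of its own, that one does stand for a requirement.) -/
def FiniteCondition (ι B : Type*) : Type _ :=
  {σ : ι → WithTop B // {n | σ n ≠ ⊤}.Finite}

/-- The extension of a map by `⊤` on the added top. -/
def extendTop [Top Z] (φ : B → Z) : WithTop B → Z :=
  WithTop.recTopCoe ⊤ φ

@[simp] theorem extendTop_top [Top Z] (φ : B → Z) : extendTop φ ⊤ = ⊤ := rfl

@[simp] theorem extendTop_coe [Top Z] (φ : B → Z) (b : B) : extendTop φ b = φ b := rfl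

theorem extendTop_mono [Preorder B] [Preorder Z] [OrderTop Z] {φ : B → Z} (hφ : Monotone φ) :
    Monotone (extendTop φ) := by
  intro c d hcd
  induction d with
  | top => exact le_top
  | coe d =>
    obtain ⟨c, rfl, -⟩ := WithTop.le_coe_iff.1 hcd
    exact hφ (WithTop.coe_le_coe.1 hcd)

theorem extendTop_inf [SemilatticeInf B] [SemilatticeInf Z] [OrderTop Z] {φ : B → Z}
    (hφ : ∀ b c, φ (b ⊓ c) = φ b ⊓ φ c) (c d : WithTop B) :
    extendTop φ (c ⊓ d) = extendTop φ c ⊓ extendTop φ d := by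
  induction c <;> induction d <;> simp [← WithTop.coe_inf, hφ]

theorem extendTop_coe_inf [SemilatticeInf B] [OrderTop B] [Top Z] (φ : B → Z) (b : B)
    (c : WithTop B) : extendTop φ (b ⊓ c) = φ (b ⊓ c.untopD ⊤) := by
  cases c
  · simp
  · rfl

theorem apply_untopD_le_extendTop [Top B] [Preorder Z] [OrderTop Z] (φ : B → Z)
    (c : WithTop B) : φ (c.untopD ⊤) ≤ extendTop φ c := by
  cases c
  · exact le_top
  · exact le_rfl

theorem iInf_eq_inf_of_eq_top [CompleteLattice Z] {f : ι → Z} {s : Finset ι}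
    (hs : ∀ n ∉ s, f n = ⊤) : ⨅ n, f n = s.inf f := by
  rw [Finset.inf_eq_iInf]
  refine le_antisymm (le_iInf₂ fun n _ => iInf_le f n) (le_iInf fun n => ?_)
  by_cases hn : n ∈ s
  · exact iInf₂_le n hn
  · exact hs n hn ▸ le_top

namespace FiniteCondition

instance : CoeFun (FiniteCondition ι B) fun _ => ι → WithTop B := ⟨Subtype.val⟩

theorem ext {σ τ : FiniteCondition ι B} (h : ∀ n, σ n = τ n) : σ = τ := Subtype.ext (funext h)

/-- The indices at which something is required. -/
noncomputable def support (σ : FiniteCondition ι B) : Finset ι := σ.2.toFinset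

theorem eq_top_of_notMem_support {σ : FiniteCondition ι B} {n : ι} (hn : n ∉ σ.support) :
    σ n = ⊤ := by
  simpa [support] using hn

open Classical in
/-- The condition that imposes the requirement `c` at the index `n` only. -/
noncomputable def single (n : ι) (c : WithTop B) : FiniteCondition ι B :=
  ⟨Function.update ⊤ n c, (Set.finite_singleton n).subset fun m hm => by
    by_contra hmn
    exact hm (Function.update_of_ne hmn _ _)⟩

@[simp] theorem single_same (n : ι) (c : WithTop B) : single n c n = c := by
  simp [single]

theorem single_of_ne {m n : ι} (h : m ≠ n) (c : WithTop B) : single n c m = ⊤ := by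
  simp [single, h]

section Order

variable [SemilatticeInf B]

instance : SemilatticeInf (FiniteCondition ι B) :=
  Subtype.semilatticeInf fun {σ τ} hσ hτ => (hσ.union hτ).subset fun n hn => by
    by_contra! h
    simp_all

instance : OrderTop (FiniteCondition ι B) :=
  Subtype.orderTop (by simp)

@[simp] theorem top_apply (n : ι) : (⊤ : FiniteCondition ι B) n = ⊤ := rfl

@[simp] theorem inf_apply (σ τ : FiniteCondition ι B) (n : ι) : (σ ⊓ τ) n = σ n ⊓ τ n := rfl

@[simp] theorem single_top (n : ι) : single n (⊤ : WithTop B) = ⊤ :=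
  ext fun m => by
    obtain rfl | h := eq_or_ne m n <;> simp [single_of_ne, *]

theorem single_inf (n : ι) (c d : WithTop B) : single n (c ⊓ d) = single n c ⊓ single n d :=
  ext fun m => by
    obtain rfl | h := eq_or_ne m n <;> simp [single_of_ne, *]

theorem inf_single (σ : FiniteCondition ι B) : σ.support.inf (fun n => single n (σ n)) = σ := by
  have apply_hom (n : ι) : ∀ s : Finset ι, ∀ f : ι → FiniteCondition ι B,
      s.inf f n = s.inf fun m => f m n := fun s f =>
    Finset.apply_inf_eq_inf_comp (g := fun τ : FiniteCondition ι B => τ n) (fun _ _ => rfl) rfl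
  refine ext fun n => (apply_hom n _ _).trans (le_antisymm ?_ (Finset.le_inf fun m _ => ?_))
  · by_cases hn : n ∈ σ.support
    · exact (Finset.inf_le hn).trans_eq (single_same n _)
    · exact le_top.trans_eq (eq_top_of_notMem_support hn).symm
  · obtain rfl | h := eq_or_ne n m
    · rw [single_same]
    · exact le_top.trans_eq (single_of_ne h (σ m)).symm

end Order

section Value

variable [CompleteLattice Z] [CompleteLattice W]

/-- The value of a condition together with an element of `A`, when the elements of `A` are
interpreted by `h` and the requirements at the index `n` by `φ n`. -/
def value (h : A → Z) (φ : ι → B → Z) (x : A × FiniteCondition ι B) : Z :=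
  h x.1 ⊓ ⨅ n, extendTop (φ n) (x.2 n)

theorem value_single (h : A → Z) (φ : ι → B → Z) (a : A) (n : ι) (b : B) :
    value h φ (a, single n b) = h a ⊓ φ n b := by
  rw [value, iInf_split_single _ n]
  simp +contextual [single_of_ne]

theorem value_eq_inf (h : A → Z) (φ : ι → B → Z) (a : A) (σ : FiniteCondition ι B) :
    value h φ (a, σ) = h a ⊓ σ.support.inf fun n => extendTop (φ n) (σ n) :=
  congrArg (h a ⊓ ·) <| iInf_eq_inf_of_eq_top fun n hn => by
    rw [eq_top_of_notMem_support hn, extendTop_top]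

theorem map_value {F : Type*} [FunLike F Z W] [InfTopHomClass F Z W] (m : F) (h : A → Z)
    (φ : ι → B → Z) (x : A × FiniteCondition ι B) :
    m (value h φ x) = value (fun a => m (h a)) (fun n b => m (φ n b)) x := by
  have extend (n : ι) (c : WithTop B) :
      m (extendTop (φ n) c) = extendTop (fun b => m (φ n b)) c := by
    cases c
    · exact map_top m
    · rfl
  obtain ⟨a, σ⟩ := x
  simp only [value_eq_inf, map_inf, map_finset_inf, Function.comp_def, extend]

theorem value_eq_inf_iInf_ne (h : A → Z) (φ : ι → B → Z) (a : A) (n : ι)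
    (σ : FiniteCondition ι B) :
    value h φ (a, σ) = h a ⊓ (extendTop (φ n) (σ n) ⊓ ⨅ m ≠ n, extendTop (φ m) (σ m)) := by
  rw [value, iInf_split_single _ n]

theorem value_le_value {h : A → Z} {φ ψ : ι → B → Z} (hφψ : ∀ n b, φ n b ≤ ψ n b)
    (x : A × FiniteCondition ι B) : value h φ x ≤ value h ψ x := by
  refine inf_le_inf_left _ (iInf_mono fun n => ?_)
  cases x.2 n
  · exact le_rfl
  · exact hφψ n _

variable [SemilatticeInf B]

theorem value_top (h : A → Z) (φ : ι → B → Z) (a : A) : value h φ (a, ⊤) = h a := by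
  simp [value]

theorem value_mono [Preorder A] {h : A → Z} {φ : ι → B → Z} (hh : Monotone h)
    (hφ : ∀ n, Monotone (φ n)) : Monotone (value h φ) := fun _ _ hxy =>
  inf_le_inf (hh hxy.1) (iInf_mono fun n => extendTop_mono (hφ n) (hxy.2 n))

theorem value_single_inf (h : A → Z) (φ : ι → B → Z) (a : A) (n : ι) (c : WithTop B)
    (σ : FiniteCondition ι B) :
    value h φ (a, single n c ⊓ σ) =
      h a ⊓ (extendTop (φ n) (c ⊓ σ n) ⊓ ⨅ m ≠ n, extendTop (φ m) (σ m)) := by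
  have tail : ⨅ m ≠ n, extendTop (φ m) ((single n c ⊓ σ) m) = ⨅ m ≠ n, extendTop (φ m) (σ m) :=
    iInf_congr fun m => iInf_congr fun hm => by rw [inf_apply, single_of_ne hm, top_inf_eq]
  rw [value, iInf_split_single _ n, tail, inf_apply, single_same]

theorem value_restrict [SemilatticeInf A] [OrderTop A]
    (ψ : InfTopHom (A × FiniteCondition ι B) Z)
    (x : A × FiniteCondition ι B) :
    value (fun a => ψ (a, ⊤)) (fun n (b : B) => ψ (⊤, single n b)) x = ψ x := by
  have extend (n : ι) (c : WithTop B) :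
      extendTop (fun b : B => ψ (⊤, single n b)) c = ψ (⊤, single n c) := by
    cases c
    · exact ((congrArg (fun τ => ψ (⊤, τ)) (single_top n)).trans (map_top ψ)).symm
    · rfl
  obtain ⟨a, σ⟩ := x
  have second : ψ (⊤, σ) = σ.support.inf fun n => ψ (⊤, single n (σ n)) := by
    conv_lhs => rw [← inf_single σ]
    exact Finset.apply_inf_eq_inf_comp (g := fun τ => ψ (⊤, τ))
      (fun τ τ' => by rw [← map_inf, Prod.mk_inf_mk, inf_idem]) (map_top ψ)
  rw [value_eq_inf, funext fun n => extend n (σ n), ← second, ← map_inf, Prod.mk_inf_mk,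
    inf_top_eq, top_inf_eq]

/-- The interpretation of conditions induced by meet-preserving interpretations of the elements of
`A` and of the requirements. -/
def valueHom [SemilatticeInf A] [OrderTop A] (h : InfTopHom A Z) (φ : ι → B → Z)
    (hφ : ∀ n b c, φ n (b ⊓ c) = φ n b ⊓ φ n c) : InfTopHom (A × FiniteCondition ι B) Z where
  toFun := value h φ
  map_inf' x y := by
    simp only [value, Prod.fst_inf, Prod.snd_inf, inf_apply, map_inf, extendTop_inf (hφ _),
      iInf_inf_eq]
    exact inf_inf_inf_comm ..
  map_top' := (value_top h φ ⊤).trans (map_top h)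

end Value

end FiniteCondition

end FiniteCondition

section DirectImage

variable {X Y : Locale.{u}} {f : X ⟶ Y}

/-- The direct image `f_! v`, that is, the least open whose inverse image contains `v`.  It is left
adjoint to `f^*` as soon as `f^*` has a left adjoint. -/
noncomputable def directImage (f : X ⟶ Y) (v : X) : Y :=
  sInf {u | v ≤ f^* u}

theorem directImage_gc (hf : Locale.IsOpenMap f) : GaloisConnection (directImage f) f^* := by
  obtain ⟨l, hl, -⟩ := hf
  rwa [show directImage f = l from funext fun v => (hl.isLeast_l (a := v)).isGLB.sInf_eq]

theorem directImage_inv_inf (hf : Locale.IsOpenMap f) (u : Y) (v : X) :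
    directImage f (f^* u ⊓ v) = u ⊓ directImage f v := by
  have hgc := directImage_gc hf
  obtain ⟨l, hl, frobenius⟩ := hf
  rw [hgc.l_unique hl fun _ => rfl, hgc.l_unique hl fun _ => rfl, frobenius]

theorem le_inv_directImage (hf : Locale.IsOpenMap f) (v : X) : v ≤ f^* (directImage f v) :=
  (directImage_gc hf).le_u_l v

theorem isOpenMap_of_isJoinDense {ι : Type*} {x : ι → X} (hx : IsJoinDense x) {φ : ι → Y}
    (h : ∀ i u c, f^* u ⊓ x i ≤ f^* c ↔ u ⊓ φ i ≤ c) : Locale.IsOpenMap f := by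
  have key := hx.inf_iSup_le_iff h
  refine ⟨fun v => ⨆ i : {i // x i ≤ v}, φ i, fun v c => ?_, fun u v => ?_⟩
  · simpa only [map_top, top_inf_eq] using (key ⊤ c v).symm
  · refine eq_of_forall_ge_iff fun c => ?_
    rw [← key u c v]
    simpa only [map_top, top_inf_eq] using (key ⊤ c (f^* u ⊓ v)).symm

end DirectImage

section BaseChange

theorem isJoinDense_pushoutTmul {A B C : Type u} [Order.Frame A] [Order.Frame B] [Order.Frame C]
    (f : FrameHom A B) (g : FrameHom A C) :
    IsJoinDense fun x : B × C => pushoutTmul f g x.1 x.2 := fun _ _ h x hx =>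
  (pushoutTmul_le_iff f g _ _ _).1 (h x ((pushoutTmul_le_iff f g _ _ _).2 hx))

variable {P X U H : Locale.{u}} {s : P ⟶ X} {r : P ⟶ U} {p : X ⟶ H} {h : U ⟶ H}

theorem inv_comm (sq : CommSq s r p h) (c : H) : s^* (p^* c) = r^* (h^* c) :=
  congrArg (·^* c) sq.w

theorem exists_orderIso_pushoutFrame (sq : IsPullback s r p h) :
    ∃ e : pushoutFrame p^* h^* ≃o P, ∀ u b, e (pushoutTmul p^* h^* u b) = s^* u ⊓ r^* b := by
  have sq' := IsPullback.of_isLimit (pullbackConeOfFramesIsLimit p h)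
  let i := sq.isoIsPullback _ _ sq'
  let e : pushoutFrame p^* h^* ≃ P :=
    ⟨i.hom^*, i.inv^*, fun D => congrArg (·^* D) i.inv_hom_id,
      fun b => congrArg (·^* b) i.hom_inv_id⟩
  refine ⟨e.toOrderIso (OrderHomClass.mono i.hom^*) (OrderHomClass.mono i.inv^*), fun u b => ?_⟩
  calc
    i.hom^* (pushoutTmul p^* h^* u b)
      = i.hom^* (pushoutInl p^* h^* u ⊓ pushoutInr p^* h^* b) :=
        congrArg i.hom^* (pushoutInl_inf_inr _ _ u b).symm
    _ = i.hom^* (pushoutInl p^* h^* u) ⊓ i.hom^* (pushoutInr p^* h^* b) := map_inf i.hom^* _ _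
    _ = s^* u ⊓ r^* b :=
      congrArg₂ (· ⊓ ·) (congrArg (·^* u) (sq.isoIsPullback_hom_fst _ _ sq'))
        (congrArg (·^* b) (sq.isoIsPullback_hom_snd _ _ sq'))

theorem isJoinDense_rectangles (sq : IsPullback s r p h) :
    IsJoinDense fun x : X × U => s^* x.1 ⊓ r^* x.2 := by
  obtain ⟨e, he⟩ := exists_orderIso_pushoutFrame sq
  simp only [← he]
  exact (isJoinDense_pushoutTmul p^* h^*).orderIso e

/-- The opens `(u, b)` of `X × U` with `h^* (p_! u) ⊓ b ≤ z`.  They form the inverse image of `z`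
under the projection of the pullback of `p` along `h` to `U`. -/
noncomputable def imageLocus (hp : Locale.IsOpenMap p) (h : U ⟶ H) (z : U) :
    pushoutFrame p^* h^* where
  val := ⟨{x | h^* (directImage p x.1) ⊓ x.2 ≤ z}, fun x y hyx hx =>
    (inf_le_inf (OrderHomClass.mono h^* ((directImage_gc hp).monotone_l hyx.1)) hyx.2).trans hx⟩
  property := by
    refine ⟨fun S c hS => ?_, fun b S hS => ?_, fun a b c => ?_⟩
    · change h^* (directImage p (sSup S)) ⊓ c ≤ z
      simp only [(directImage_gc hp).l_sSup, map_iSup, iSup_inf_eq]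
      exact iSup₂_le hS
    · change h^* (directImage p b) ⊓ sSup S ≤ z
      rw [inf_sSup_eq]
      exact iSup₂_le hS
    · change h^* (directImage p (b ⊓ p^* a)) ⊓ c ≤ z ↔ h^* (directImage p b) ⊓ (c ⊓ h^* a) ≤ z
      rw [inf_comm b, directImage_inv_inf hp, map_inf, inf_comm c, ← inf_assoc,
        inf_comm (h^* a)]

theorem rectangle_le_inv_iff (sq : IsPullback s r p h) (hp : Locale.IsOpenMap p) {u : X} {b z : U} :
    s^* u ⊓ r^* b ≤ r^* z ↔ h^* (directImage p u) ⊓ b ≤ z := by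
  constructor
  · obtain ⟨e, he⟩ := exists_orderIso_pushoutFrame sq
    intro hz
    have tmul_le : pushoutTmul p^* h^* u b ≤ pushoutTmul p^* h^* ⊤ z := by
      rw [← e.le_iff_le, he, he, map_top, top_inf_eq]
      exact hz
    have le_locus : pushoutTmul p^* h^* ⊤ z ≤ imageLocus hp h z :=
      (pushoutTmul_le_iff _ _ _ _ _).2 inf_le_right
    exact (pushoutTmul_le_iff _ _ _ _ _).1 (tmul_le.trans le_locus)
  · intro hz
    calc
      s^* u ⊓ r^* b ≤ s^* (p^* (directImage p u)) ⊓ r^* b :=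
        inf_le_inf_right _ (OrderHomClass.mono s^* (le_inv_directImage hp u))
      _ = r^* (h^* (directImage p u) ⊓ b) := by rw [inv_comm sq.toCommSq, map_inf]
      _ ≤ r^* z := OrderHomClass.mono r^* hz

theorem inv_inf_rectangle_le_inv_iff (sq : IsPullback s r p h) (hp : Locale.IsOpenMap p)
    (x : X × U) (a c : U) :
    r^* a ⊓ (s^* x.1 ⊓ r^* x.2) ≤ r^* c ↔ a ⊓ (h^* (directImage p x.1) ⊓ x.2) ≤ c := by
  rw [inf_left_comm, ← map_inf, rectangle_le_inv_iff sq hp, inf_left_comm]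

theorem isOpenMap_of_isPullback (sq : IsPullback s r p h) (hp : Locale.IsOpenMap p) :
    Locale.IsOpenMap r :=
  isOpenMap_of_isJoinDense (isJoinDense_rectangles sq) (inv_inf_rectangle_le_inv_iff sq hp)

/-- The class of open morphisms of locales. -/
def openMaps : MorphismProperty Locale.{u} := fun _ _ f => Locale.IsOpenMap f

instance : openMaps.{u}.IsStableUnderBaseChange where
  of_isPullback sq hp := isOpenMap_of_isPullback sq hp

theorem isLocalHomeo_snd (hp : IsLocalHomeo p) (h : U ⟶ H) : IsLocalHomeo (pullback.snd p h) :=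
  ⟨openMaps.pullback_snd p h hp.1, openMaps.diagonal.pullback_snd p h hp.2⟩

theorem directImage_rectangle (sq : IsPullback s r p h) (hp : Locale.IsOpenMap p) (u : X) (b : U) :
    directImage r (s^* u ⊓ r^* b) = h^* (directImage p u) ⊓ b :=
  eq_of_forall_ge_iff fun _ =>
    (directImage_gc (isOpenMap_of_isPullback sq hp) _ _).trans (rectangle_le_inv_iff sq hp)

theorem directImage_inv_eq_inv_directImage (sq : IsPullback s r p h) (hp : Locale.IsOpenMap p)
    (u : X) : directImage r (s^* u) = h^* (directImage p u) := by
  simpa only [map_top, inf_top_eq] using directImage_rectangle sq hp u ⊤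

end BaseChange

section Sections

variable {Y U : Locale.{u}} {r : Y ⟶ U}

theorem inv_diagonal_inv_fst (r : Y ⟶ U) (u : Y) :
    (pullback.diagonal r)^* ((pullback.fst r r)^* u) = u :=
  congrArg (·^* u) (pullback.diagonal_fst r)

theorem inv_diagonal_inv_snd (r : Y ⟶ U) (u : Y) :
    (pullback.diagonal r)^* ((pullback.snd r r)^* u) = u :=
  congrArg (·^* u) (pullback.diagonal_snd r)

theorem eqPred_eq_directImage (hr : IsLocalHomeo r) :
    eqPred r = directImage (pullback.diagonal r) ⊤ :=
  eqPred_eq r _ (directImage_gc hr.2)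

theorem inv_diagonal_eqPred (hr : IsLocalHomeo r) : (pullback.diagonal r)^* (eqPred r) = ⊤ :=
  top_unique (eqPred_eq_directImage hr ▸ le_inv_directImage hr.2 ⊤)

theorem inv_fst_inf_eqPred_le (hr : IsLocalHomeo r) (w : Y) :
    (pullback.fst r r)^* w ⊓ eqPred r ≤ (pullback.snd r r)^* w := by
  rw [eqPred_eq_directImage hr, ← directImage_inv_inf hr.2, inf_top_eq, directImage_gc hr.2,
    inv_diagonal_inv_fst, inv_diagonal_inv_snd]

theorem iSup_inf_inv_le_eqPred (hr : IsLocalHomeo r) :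
    ⨆ w : {w // (pullback.fst r r)^* w ⊓ (pullback.snd r r)^* w ≤ eqPred r}, (w : Y) = ⊤ := by
  have covered := (isJoinDense_rectangles (IsPullback.of_hasPullback r r)).iSup_eq (eqPred r)
  refine top_unique <| (inv_diagonal_eqPred hr).ge.trans ?_
  conv_lhs => rw [← covered]
  rw [map_iSup, iSup_le_iff]
  rintro ⟨⟨a, b⟩, hab⟩
  rw [map_inf, inv_diagonal_inv_fst, inv_diagonal_inv_snd]
  have hle : (pullback.fst r r)^* (a ⊓ b) ⊓ (pullback.snd r r)^* (a ⊓ b) ≤ eqPred r :=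
    (inf_le_inf (OrderHomClass.mono _ inf_le_left) (OrderHomClass.mono _ inf_le_right)).trans hab
  exact le_iSup_of_le ⟨a ⊓ b, hle⟩ le_rfl

/-- An open `u` is a section of `r` if `r` is injective on it, that is, if every part `u ⊓ w` of `u`
is the trace on `u` of the saturation of `u ⊓ w` along `r`. -/
def IsSection (r : Y ⟶ U) (u : Y) : Prop :=
  ∀ w, u ⊓ r^* (directImage r (u ⊓ w)) ≤ w

theorem IsSection.inf_inv_directImage {u : Y} (hu : IsSection r u) (hr : Locale.IsOpenMap r)
    (w : Y) : u ⊓ r^* (directImage r (u ⊓ w)) = u ⊓ w :=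
  le_antisymm (le_inf inf_le_left (hu w)) (le_inf inf_le_left (le_inv_directImage hr _))

theorem isSection_of_isJoinDense {ι : Type*} {x : ι → Y} (hx : IsJoinDense x)
    (hr : Locale.IsOpenMap r) {u : Y}
    (hu : ∀ i, u ⊓ r^* (directImage r (u ⊓ x i)) ≤ x i) : IsSection r u :=
  hx.induction hu fun S hS => by
    simp only [inf_sSup_eq, (directImage_gc hr).l_iSup, map_iSup, inf_iSup_eq]
    exact iSup₂_le fun b hb => (hS b hb).trans (le_sSup hb)

theorem isSection_iff (hr : IsLocalHomeo r) {u : Y} :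
    IsSection r u ↔ (pullback.fst r r)^* u ⊓ (pullback.snd r r)^* u ≤ eqPred r := by
  have sq := IsPullback.of_hasPullback r r
  constructor
  · intro hu
    have agree (w : Y) :
        (pullback.fst r r)^* (u ⊓ w) ⊓ (pullback.snd r r)^* u ≤ (pullback.snd r r)^* w := calc
      _ ≤ (pullback.fst r r)^* (r^* (directImage r (u ⊓ w))) ⊓ (pullback.snd r r)^* u :=
        inf_le_inf_right _ (OrderHomClass.mono _ (le_inv_directImage hr.1 _))
      _ = (pullback.snd r r)^* (u ⊓ r^* (directImage r (u ⊓ w))) := by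
        rw [inv_comm sq.toCommSq, ← map_inf, inf_comm]
      _ ≤ (pullback.snd r r)^* w := OrderHomClass.mono _ (hu w)
    rw [← inf_top_eq u, ← iSup_inf_inv_le_eqPred hr, inf_iSup_eq, map_iSup, iSup_inf_eq,
      ← inf_iSup_eq, iSup_inf_inv_le_eqPred hr, inf_top_eq]
    exact iSup_le fun w =>
      (le_inf (inf_le_left.trans (OrderHomClass.mono _ inf_le_right)) (agree w)).trans w.2
  · intro hu w
    rw [← directImage_inv_eq_inv_directImage sq hr.1,
      ← directImage_inv_inf (isOpenMap_of_isPullback sq hr.1),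
      directImage_gc (isOpenMap_of_isPullback sq hr.1), map_inf, ← inf_assoc, inf_comm]
    calc
      (pullback.fst r r)^* w ⊓ ((pullback.snd r r)^* u ⊓ (pullback.fst r r)^* u)
        ≤ (pullback.fst r r)^* w ⊓ eqPred r := inf_le_inf_left _ ((inf_comm _ _).trans_le hu)
      _ ≤ (pullback.snd r r)^* w := inv_fst_inf_eqPred_le hr w

theorem iSup_isSection (hr : IsLocalHomeo r) : ⨆ u : {u // IsSection r u}, (u : Y) = ⊤ :=
  top_unique <| (iSup_inf_inv_le_eqPred hr).ge.trans <| iSup_le fun w =>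
    le_iSup_of_le ⟨w, (isSection_iff hr).2 w.2⟩ le_rfl

end Sections

section Incidence

variable {P X U H : Locale.{u}} {s : P ⟶ X} {r : P ⟶ U} {p : X ⟶ H} {h : U ⟶ H}

/-- The incidence relation of an open `F` of the pullback `P` of `p : X ⟶ H` along `h : U ⟶ H`:
the open of `U` over which `F` meets the open `u` of `X`. -/
noncomputable def incidence (s : P ⟶ X) (r : P ⟶ U) (F : P) (u : X) : U :=
  directImage r (F ⊓ s^* u)

/-- The open of the pullback `P` with a given incidence relation `φ`.  It suffices to describe it
over the sections of `p`, where meeting an open is the same as lying in it. -/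
noncomputable def ofIncidence (p : X ⟶ H) (s : P ⟶ X) (r : P ⟶ U) (φ : X → U) : P :=
  ⨆ u : {u // IsSection p u}, s^* u ⊓ r^* (φ u)

/-- The maps of opens that preserve joins and are linear over the opens of the base `H`. -/
structure IsBaseLinear (p : X ⟶ H) (h : U ⟶ H) (φ : X → U) : Prop where
  map_sSup : ∀ S : Set X, φ (sSup S) = ⨆ u ∈ S, φ u
  map_inf_inv : ∀ (u : X) (c : H), φ (u ⊓ p^* c) = φ u ⊓ h^* c

theorem IsBaseLinear.map_iSup {φ : X → U} (hφ : IsBaseLinear p h φ) {κ : Type*} (v : κ → X) :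
    φ (⨆ i, v i) = ⨆ i, φ (v i) := by
  rw [iSup, hφ.map_sSup, iSup_range]

section

variable (sq : IsPullback s r p h) (hp : Locale.IsOpenMap p)
include sq hp

theorem IsSection.inv_of_isPullback {u : X} (hu : IsSection p u) : IsSection r (s^* u) := by
  refine isSection_of_isJoinDense (isJoinDense_rectangles sq) (isOpenMap_of_isPullback sq hp) ?_
  rintro ⟨a, b⟩
  calc
    s^* u ⊓ r^* (directImage r (s^* u ⊓ (s^* a ⊓ r^* b)))
      = s^* (u ⊓ p^* (directImage p (u ⊓ a))) ⊓ r^* b := by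
        rw [← inf_assoc, ← map_inf, directImage_rectangle sq hp, map_inf, ← inv_comm sq.toCommSq,
          map_inf, inf_assoc]
    _ ≤ s^* a ⊓ r^* b := inf_le_inf_right _ (OrderHomClass.mono s^* (hu a))

theorem isBaseLinear_incidence (F : P) : IsBaseLinear p h (incidence s r F) where
  map_sSup S := by
    rw [incidence, sSupHomClass.map_sSup, inf_sSup_eq, iSup_image]
    simp only [incidence, (directImage_gc (isOpenMap_of_isPullback sq hp)).l_iSup]
  map_inf_inv u c := by
    rw [incidence, map_inf, inv_comm sq.toCommSq, ← inf_assoc, inf_comm,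
      directImage_inv_inf (isOpenMap_of_isPullback sq hp), inf_comm, incidence]

theorem incidence_top (u : X) : incidence s r ⊤ u = h^* (directImage p u) := by
  rw [incidence, top_inf_eq, directImage_inv_eq_inv_directImage sq hp]

theorem incidence_iSup {κ : Type*} (F : κ → P) (u : X) :
    incidence s r (⨆ n, F n) u = ⨆ n, incidence s r (F n) u := by
  simp only [incidence, iSup_inf_eq, (directImage_gc (isOpenMap_of_isPullback sq hp)).l_iSup]

end

theorem iSup_inv_isSection (hp : IsLocalHomeo p) (s : P ⟶ X) :
    ⨆ u : {u // IsSection p u}, s^* (u : X) = ⊤ := by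
  rw [← map_iSup, iSup_isSection hp, map_top]

section

variable (sq : IsPullback s r p h) (hp : IsLocalHomeo p)
include sq hp

theorem ofIncidence_incidence (F : P) : ofIncidence p s r (incidence s r F) = F := by
  refine le_antisymm (iSup_le fun u => ?_) ?_
  · rw [incidence, inf_comm F]
    exact u.2.inv_of_isPullback sq hp.1 F
  · calc
      F = ⨆ u : {u // IsSection p u}, F ⊓ s^* (u : X) := by
        rw [← inf_iSup_eq, iSup_inv_isSection hp, inf_top_eq]
      _ ≤ ofIncidence p s r (incidence s r F) := iSup_mono fun u =>
        le_inf inf_le_right (le_inv_directImage (isOpenMap_of_isPullback sq hp.1) _)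

theorem incidence_ofIncidence {φ : X → U} (hφ : IsBaseLinear p h φ) :
    incidence s r (ofIncidence p s r φ) = φ := by
  funext w
  calc
    incidence s r (ofIncidence p s r φ) w
      = ⨆ u : {u // IsSection p u}, h^* (directImage p (u ⊓ w)) ⊓ φ u := by
        rw [ofIncidence, incidence_iSup sq hp.1]
        refine iSup_congr fun u => ?_
        rw [incidence, inf_right_comm, ← map_inf, directImage_rectangle sq hp.1]
    _ = ⨆ u : {u // IsSection p u}, φ (u ⊓ w) := iSup_congr fun u => by
        rw [inf_comm, ← hφ.map_inf_inv, u.2.inf_inv_directImage hp.1]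
    _ = φ w := by
        rw [← hφ.map_iSup, ← iSup_inf_eq, iSup_isSection hp, top_inf_eq]

theorem iSup_eq_top_iff_incidence {κ : Type*} (F : κ → P) :
    ⨆ n, F n = ⊤ ↔ ∀ u, ⨆ n, incidence s r (F n) u = h^* (directImage p u) := by
  simp only [← incidence_iSup sq hp.1, ← incidence_top sq hp.1, ← funext_iff]
  exact (Function.LeftInverse.injective (ofIncidence_incidence sq hp)).eq_iff.symm

theorem isSection_iff_incidence_inf (F : P) :
    IsSection r F ↔ ∀ u w, incidence s r F (u ⊓ w) = incidence s r F u ⊓ incidence s r F w := by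
  have hr := isOpenMap_of_isPullback sq hp.1
  constructor
  · intro hF u w
    have trace : r^* (incidence s r F u) ⊓ (F ⊓ s^* w) = F ⊓ s^* (u ⊓ w) := by
      rw [incidence, ← inf_assoc, inf_comm _ F, hF.inf_inv_directImage hr, inf_assoc, map_inf]
    rw [incidence, ← trace, directImage_inv_inf hr, incidence, incidence]
  · intro hF
    have trace_le (a : X) : F ⊓ r^* (incidence s r F a) ≤ s^* a := calc
      F ⊓ r^* (incidence s r F a)
        = ofIncidence p s r (incidence s r F) ⊓ r^* (incidence s r F a) := by
          rw [ofIncidence_incidence sq hp F]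
      _ = ⨆ u : {u // IsSection p u}, s^* u ⊓ r^* (incidence s r F (u ⊓ a)) := by
          simp only [ofIncidence, iSup_inf_eq, inf_assoc, ← map_inf, ← hF]
      _ ≤ s^* a := iSup_le fun u => by
          rw [incidence, map_inf, inf_left_comm]
          exact (u.2.inv_of_isPullback sq hp.1 _).trans inf_le_right
    refine isSection_of_isJoinDense (isJoinDense_rectangles sq) hr ?_
    rintro ⟨a, b⟩
    calc
      F ⊓ r^* (directImage r (F ⊓ (s^* a ⊓ r^* b)))
        = (F ⊓ r^* (incidence s r F a)) ⊓ r^* b := by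
          rw [← inf_assoc, inf_comm _ (r^* b), directImage_inv_inf hr, map_inf, incidence,
            inf_comm (r^* b), inf_assoc]
      _ ≤ s^* a ⊓ r^* b := inf_le_inf_right _ (trace_le a)

end

end Incidence

section Enumeration

open FiniteCondition

variable {ι : Type} {X H U V : Locale.{u}} {p : X ⟶ H} {h : U ⟶ H}

/-- The incidence relations of a partial surjection from `ι` onto the fibre of `p` over `h`: the
open `φ n u` of `U` stands for `⟦f n ∈ u⟧`.  The field `map_inf` expresses functionality and
`iSup_eq` expresses surjectivity. -/
structure IsEnumeration (p : X ⟶ H) (h : U ⟶ H) (φ : ι → X → U) : Prop where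
  isBaseLinear : ∀ n, IsBaseLinear p h (φ n)
  map_inf : ∀ n u v, φ n (u ⊓ v) = φ n u ⊓ φ n v
  iSup_eq : ∀ u, ⨆ n, φ n u = h^* (directImage p u)

theorem IsEnumeration.inv_comp {φ : ι → X → U} (hφ : IsEnumeration p h φ) (g : V ⟶ U) :
    IsEnumeration p (g ≫ h) fun n u => g^* (φ n u) where
  isBaseLinear n :=
    { map_sSup := fun S => by
        simp only [(hφ.isBaseLinear n).map_sSup, map_iSup]
      map_inf_inv := fun u c => by
        rw [(hφ.isBaseLinear n).map_inf_inv, InfHomClass.map_inf, Locale.inv_comp,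
          FrameHom.comp_apply] }
  map_inf n u v := by rw [hφ.map_inf, InfHomClass.map_inf]
  iSup_eq u := by rw [← map_iSup, hφ.iSup_eq]; rfl

/-- The relations presenting the locale of enumerations.  The generator `(c, σ)` stands for the
open where the base point lies in `c` and the condition `σ` holds, in which the requirement `u` at
the index `n` means that `f n` is defined and lies in `u`. -/
inductive Cover (ι : Type) (p : X ⟶ H) :
    H × FiniteCondition ι X → Set (H × FiniteCondition ι X) → Prop
  | base (S : Set H) : Cover ι p (sSup S, ⊤) ((fun c => (c, ⊤)) '' S)
  | requirement (n : ι) (S : Set X) : Cover ι p (⊤, .single n ↑(sSup S))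
      ((fun u : X => (⊤, .single n ↑u)) '' S)
  | base_of_inv (n : ι) (c : H) : Cover ι p (⊤, .single n ↑(p^* c)) {(c, ⊤)}
  | inv_of_base (n : ι) (c : H) : Cover ι p (c, .single n ↑(⊤ : X)) {(⊤, .single n ↑(p^* c))}
  | surjective (u : X) : Cover ι p (directImage p u, ⊤)
      (Set.range fun n => (⊤, .single n ↑u))

/-- The locale of base points with a partial surjection from `ι` onto the fibre of `p`. -/
def enumerationLocale (ι : Type) (p : X ⟶ H) : Locale.{u} :=
  Locale.of (presentedFrame (Cover ι p))

variable (ι p) in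
/-- The basic opens of the enumeration locale, which restrict the base point to an open and impose
a finite condition on the partial surjection. -/
noncomputable def basicOpen : InfTopHom (H × FiniteCondition ι X) (enumerationLocale ι p) :=
  generator (Cover ι p)

variable (ι p) in
/-- The morphism that forgets the partial surjection. -/
noncomputable def enumerationBase : enumerationLocale ι p ⟶ H :=
  ofInv (Y := H)
    { toFun c := basicOpen ι p (c, ⊤)
      map_inf' c d := by rw [← map_inf, Prod.mk_inf_mk, inf_idem]
      map_top' := map_top (basicOpen ι p)
      map_sSup' S := by
        rw [sSup_image]
        refine le_antisymm ?_ (iSup₂_le fun c hc => OrderHomClass.mono (basicOpen ι p)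
          ⟨le_sSup hc, le_rfl⟩)
        exact (generator_le_iSup (Cover.base (p := p) S)).trans_eq iSup_image }

/-- The open `⟦f n ∈ u⟧` of the enumeration locale, for the generic partial surjection `f`. -/
noncomputable def genericIncidence (p : X ⟶ H) (n : ι) (u : X) : enumerationLocale ι p :=
  basicOpen ι p (⊤, single n ↑u)

theorem genericIncidence_inf (n : ι) (u v : X) :
    genericIncidence p n (u ⊓ v) = genericIncidence p n u ⊓ genericIncidence p n v := by
  rw [genericIncidence, genericIncidence, genericIncidence, ← map_inf, Prod.mk_inf_mk, inf_idem,
    ← single_inf, WithTop.coe_inf]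

theorem genericIncidence_mono (p : X ⟶ H) (n : ι) : Monotone (genericIncidence p n) :=
  fun u v huv => by
    rw [← inf_eq_left.2 huv, genericIncidence_inf]
    exact inf_le_right

theorem genericIncidence_sSup (n : ι) (S : Set X) :
    genericIncidence p n (sSup S) = ⨆ u ∈ S, genericIncidence p n u := by
  refine le_antisymm ?_ (iSup₂_le fun u hu => genericIncidence_mono p n (le_sSup hu))
  exact (generator_le_iSup (Cover.requirement (p := p) n S)).trans_eq iSup_image

theorem genericIncidence_inv_le (n : ι) (c : H) :
    genericIncidence p n (p^* c) ≤ (enumerationBase ι p)^* c :=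
  (generator_le_iSup (Cover.base_of_inv (p := p) n c)).trans_eq iSup_singleton

theorem inv_inf_genericIncidence_le (n : ι) (c : H) (u : X) :
    (enumerationBase ι p)^* c ⊓ genericIncidence p n u ≤ genericIncidence p n (p^* c) := calc
  (enumerationBase ι p)^* c ⊓ genericIncidence p n u
    ≤ (enumerationBase ι p)^* c ⊓ genericIncidence p n ⊤ :=
      inf_le_inf_left _ (genericIncidence_mono p n le_top)
  _ = basicOpen ι p (c, .single n ↑(⊤ : X)) := by
      refine (map_inf (basicOpen ι p) _ _).symm.trans (congrArg _ ?_)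
      rw [Prod.mk_inf_mk, inf_top_eq, top_inf_eq]
  _ ≤ genericIncidence p n (p^* c) :=
      (generator_le_iSup (Cover.inv_of_base (p := p) n c)).trans_eq iSup_singleton

theorem genericIncidence_le_inv_directImage (hp : Locale.IsOpenMap p) (n : ι) (u : X) :
    genericIncidence p n u ≤ (enumerationBase ι p)^* (directImage p u) :=
  (genericIncidence_mono p n (le_inv_directImage hp u)).trans (genericIncidence_inv_le n _)

theorem isEnumeration_genericIncidence (hp : Locale.IsOpenMap p) :
    IsEnumeration p (enumerationBase ι p) (genericIncidence p) where
  isBaseLinear n :=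
    { map_sSup := genericIncidence_sSup n
      map_inf_inv := fun u c => by
        rw [genericIncidence_inf]
        refine le_antisymm (inf_le_inf_left _ (genericIncidence_inv_le n c))
          (le_inf inf_le_left ?_)
        rw [inf_comm]
        exact inv_inf_genericIncidence_le n c u }
  map_inf := genericIncidence_inf
  iSup_eq u := le_antisymm (iSup_le fun n => genericIncidence_le_inv_directImage hp n u)
    ((generator_le_iSup (Cover.surjective (ι := ι) (p := p) u)).trans_eq iSup_range)

theorem IsEnumeration.value_le_iSup_of_cover {φ : ι → X → U} (hφ : IsEnumeration p h φ)
    {x : H × FiniteCondition ι X} {S : Set (H × FiniteCondition ι X)} (hS : Cover ι p x S) :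
    value h^* φ x ≤ ⨆ s ∈ S, value h^* φ s := by
  cases hS with
  | base S => simp only [iSup_image, value_top, map_sSup, sSup_image]; rfl
  | requirement n S =>
    simp only [iSup_image, value_single, map_top, top_inf_eq, (hφ.isBaseLinear n).map_sSup, le_refl]
  | base_of_inv n c =>
    rw [iSup_singleton, value_single, value_top, map_top, top_inf_eq, ← top_inf_eq (p^* c),
      (hφ.isBaseLinear n).map_inf_inv]
    exact inf_le_right
  | inv_of_base n c =>
    rw [iSup_singleton, value_single, value_single, map_top, top_inf_eq, ← top_inf_eq (p^* c),
      (hφ.isBaseLinear n).map_inf_inv, inf_comm]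
  | surjective u =>
    simp only [iSup_range, value_single, value_top, map_top, top_inf_eq, hφ.iSup_eq, le_refl]

/-- The generalised point of the enumeration locale given by a partial surjection. -/
noncomputable def IsEnumeration.classify {φ : ι → X → U} (hφ : IsEnumeration p h φ) :
    U ⟶ enumerationLocale ι p :=
  ofInv (Y := enumerationLocale ι p) <|
    lift (valueHom (h^*).toInfTopHom φ hφ.map_inf) fun _ _ => hφ.value_le_iSup_of_cover

theorem IsEnumeration.inv_classify_basicOpen {φ : ι → X → U} (hφ : IsEnumeration p h φ)
    (x : H × FiniteCondition ι X) : hφ.classify^* (basicOpen ι p x) = value h^* φ x :=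
  lift_generator _ (fun _ _ => hφ.value_le_iSup_of_cover) x

/-- The universal property of the enumeration locale. -/
noncomputable def pointEquiv (hp : Locale.IsOpenMap p) (U : Locale.{u}) :
    (U ⟶ enumerationLocale ι p) ≃
      {x : (U ⟶ H) × (ι → X → U) // IsEnumeration p x.1 x.2} where
  toFun t := ⟨(t ≫ enumerationBase ι p, fun n u => t^* (genericIncidence p n u)),
    (isEnumeration_genericIncidence hp).inv_comp t⟩
  invFun x := x.2.classify
  left_inv t := congrArg ofInv <| frameHom_ext (m' := t^*) fun x =>
    (((isEnumeration_genericIncidence hp).inv_comp t).inv_classify_basicOpen x).trans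
      (value_restrict ((t^*).toInfTopHom.comp (basicOpen ι p)) x)
  right_inv x := by
    refine Subtype.ext <| Prod.ext (Locale.hom_ext fun c => ?_) (funext₂ fun n u => ?_)
    · exact (x.2.inv_classify_basicOpen _).trans (value_top _ _ c)
    · refine (x.2.inv_classify_basicOpen _).trans ?_
      rw [value_single, map_top, top_inf_eq]

section Openness

variable (ι p) in
/-- The open of the base over which a condition is satisfied by some partial surjection: there, each
required open meets the fibre.  As `ι` is infinite, this is enough, since the indices that are not
mentioned by the condition suffice to enumerate the fibre. -/
noncomputable def satisfiable (x : H × FiniteCondition ι X) : H :=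
  value (fun c => c) (fun _ => directImage p) x

theorem satisfiable_mono (hp : Locale.IsOpenMap p) : Monotone (satisfiable ι p) :=
  value_mono monotone_id fun _ => (directImage_gc hp).monotone_l

theorem satisfiable_le_iSup_of_cover [Infinite ι] (hp : Locale.IsOpenMap p)
    ⦃x : H × FiniteCondition ι X⦄ ⦃S : Set (H × FiniteCondition ι X)⦄ (hS : Cover ι p x S)
    (y : H × FiniteCondition ι X) :
    satisfiable ι p (x ⊓ y) ≤ ⨆ s ∈ S, satisfiable ι p (s ⊓ y) := by
  obtain ⟨b, σ⟩ := y
  have image_sSup (S : Set X) (v : X) :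
      directImage p (sSup S ⊓ v) = ⨆ u ∈ S, directImage p (u ⊓ v) := by
    simp only [sSup_inf_eq, (directImage_gc hp).l_iSup]
  cases hS with
  | base S =>
    simp only [iSup_image, satisfiable, value, Prod.mk_inf_mk, sSup_inf_eq, iSup_inf_eq, le_refl]
  | requirement n S =>
    simp only [iSup_image, satisfiable, Prod.mk_inf_mk, value_single_inf]
    simp only [extendTop_coe_inf, image_sSup, iSup_inf_eq, inf_iSup_eq, le_refl]
  | base_of_inv n c =>
    simp only [iSup_singleton, satisfiable, Prod.mk_inf_mk, value_single_inf]
    rw [top_inf_eq σ, value_eq_inf_iInf_ne _ _ _ n, extendTop_coe_inf, directImage_inv_inf hp,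
      top_inf_eq b, inf_comm c b, inf_assoc b c, inf_assoc c]
    gcongr
    exact apply_untopD_le_extendTop _ _
  | inv_of_base n c =>
    simp only [iSup_singleton, satisfiable, Prod.mk_inf_mk, value_single_inf]
    rw [extendTop_coe_inf, extendTop_coe_inf, directImage_inv_inf hp, top_inf_eq, top_inf_eq,
      inf_comm c b, inf_assoc b c, inf_assoc c]
  | surjective u =>
    obtain ⟨n, hn⟩ := Infinite.exists_notMem_finset σ.support
    rw [iSup_range]
    refine le_iSup_of_le n ?_
    simp only [satisfiable, Prod.mk_inf_mk, value_single_inf]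
    rw [top_inf_eq σ, value_eq_inf_iInf_ne _ _ _ n, eq_top_of_notMem_support hn,
      extendTop_top, top_inf_eq, inf_top_eq, extendTop_coe, top_inf_eq, inf_comm _ b, inf_assoc]

theorem basicOpen_le_inv_enumerationBase_iff [Infinite ι] (hp : Locale.IsOpenMap p)
    (x : H × FiniteCondition ι X) (c : H) :
    basicOpen ι p x ≤ (enumerationBase ι p)^* c ↔ satisfiable ι p x ≤ c := by
  have le_sublevel {x : H × FiniteCondition ι X} {c : H} :=
    generator_le_sublevel_iff (satisfiable_mono (ι := ι) hp)
      (satisfiable_le_iSup_of_cover hp) (x := x) (z := c)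
  constructor
  · intro hx
    exact le_sublevel.1 (hx.trans (le_sublevel.2 (value_top _ _ c).le))
  · intro hx
    calc
      basicOpen ι p x
        = value (enumerationBase ι p)^* (genericIncidence p) x :=
          (value_restrict (basicOpen ι p) x).symm
      _ ≤ value (enumerationBase ι p)^*
            (fun _ u => (enumerationBase ι p)^* (directImage p u)) x :=
          value_le_value (genericIncidence_le_inv_directImage hp) x
      _ = (enumerationBase ι p)^* (satisfiable ι p x) := (map_value _ _ _ x).symm
      _ ≤ (enumerationBase ι p)^* c := OrderHomClass.mono _ hx

theorem isOpenMap_enumerationBase [Infinite ι] (hp : Locale.IsOpenMap p) :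
    Locale.IsOpenMap (enumerationBase ι p) := by
  refine isOpenMap_of_isJoinDense (isJoinDense_generator (R := Cover ι p))
    (φ := satisfiable ι p) fun x a c => ?_
  rw [show a ⊓ satisfiable ι p x = satisfiable ι p ((a, ⊤) ⊓ x) by
      simp [satisfiable, value, inf_assoc],
    ← basicOpen_le_inv_enumerationBase_iff hp, map_inf]
  rfl

theorem inv_enumerationBase_le_iff [Infinite ι] (hp : Locale.IsOpenMap p) (c d : H) :
    (enumerationBase ι p)^* c ≤ (enumerationBase ι p)^* d ↔ c ≤ d := by
  refine (basicOpen_le_inv_enumerationBase_iff hp (c, ⊤) d).trans ?_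
  rw [satisfiable, value_top]

theorem isOpenSurjection_enumerationBase [Infinite ι] (hp : Locale.IsOpenMap p) :
    IsOpenSurjection (enumerationBase ι p) := by
  refine ⟨isOpenMap_enumerationBase hp, ⟨fun g g' hgg' => Locale.hom_ext fun v => ?_⟩⟩
  have inj : Function.Injective (enumerationBase ι p)^* := fun c d hcd =>
    le_antisymm ((inv_enumerationBase_le_iff hp c d).1 hcd.le)
      ((inv_enumerationBase_le_iff hp d c).1 hcd.ge)
  exact inj (congrArg (·^* v) hgg')

end Openness

end Enumeration

section PartialSurjection

variable {X H U V : Locale.{u}} {p : X ⟶ H}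

theorem inv_fibreMap_ofIncidence (g : V ⟶ U) {h : U ⟶ H} {h' : V ⟶ H} (w : h' = g ≫ h)
    (φ : X → U) :
    (fibreMap p g w)^* (ofIncidence p (pullback.fst p h) (pullback.snd p h) φ) =
      ofIncidence p (pullback.fst p h') (pullback.snd p h') fun u => g^* (φ u) := by
  have fst (u : X) : (fibreMap p g w)^* ((pullback.fst p h)^* u) = (pullback.fst p h')^* u :=
    congrArg (·^* u) (pullback.lift_fst _ _ _)
  have snd (b : U) :
      (fibreMap p g w)^* ((pullback.snd p h)^* b) = (pullback.snd p h')^* (g^* b) :=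
    congrArg (·^* b) (pullback.lift_snd _ _ _)
  simp only [ofIncidence, map_iSup, map_inf, fst, snd]

variable (hp : IsLocalHomeo p)
include hp

theorem isEnumeration_incidence {h : U ⟶ H} (f : PartialSurjection (pullback.snd p h)) :
    IsEnumeration p h fun n => incidence (pullback.fst p h) (pullback.snd p h) (f.graph n) where
  isBaseLinear _ := isBaseLinear_incidence (IsPullback.of_hasPullback p h) hp.1 _
  map_inf _ := (isSection_iff_incidence_inf (IsPullback.of_hasPullback p h) hp _).1
    ((isSection_iff (isLocalHomeo_snd hp h)).2 (f.functional _))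
  iSup_eq := (iSup_eq_top_iff_incidence (IsPullback.of_hasPullback p h) hp _).1 f.surjective

/-- The partial surjection with given incidence relations. -/
noncomputable def IsEnumeration.partialSurjection {h : U ⟶ H} {φ : ℕ → X → U}
    (hφ : IsEnumeration p h φ) : PartialSurjection (pullback.snd p h) where
  graph n := ofIncidence p (pullback.fst p h) (pullback.snd p h) (φ n)
  functional n := by
    have sq := IsPullback.of_hasPullback p h
    rw [← isSection_iff (isLocalHomeo_snd hp h), isSection_iff_incidence_inf sq hp,
      incidence_ofIncidence sq hp (hφ.isBaseLinear n)]
    exact hφ.map_inf n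
  surjective := by
    have sq := IsPullback.of_hasPullback p h
    simp only [iSup_eq_top_iff_incidence sq hp, incidence_ofIncidence sq hp (hφ.isBaseLinear _)]
    exact hφ.iSup_eq

/-- Partial surjections onto the fibres correspond to their incidence relations. -/
noncomputable def graphEquiv (U : Locale.{u}) :
    {x : (U ⟶ H) × (ℕ → X → U) // IsEnumeration p x.1 x.2} ≃ FibrePartialSurjection p U where
  toFun x := ⟨x.1.1, x.2.partialSurjection hp⟩
  invFun f := ⟨(f.point, _), isEnumeration_incidence hp f.partialSurjection⟩
  left_inv := by
    rintro ⟨⟨h, φ⟩, hφ⟩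
    exact Subtype.ext <| Prod.ext rfl <| funext fun n =>
      incidence_ofIncidence (IsPullback.of_hasPullback p h) hp (hφ.isBaseLinear n)
  right_inv := by
    rintro ⟨h, ⟨F, _, _⟩⟩
    have graph_eq := funext fun n => ofIncidence_incidence (IsPullback.of_hasPullback p h) hp (F n)
    exact congrArg _ ((PartialSurjection.mk.injEq ..).mpr graph_eq)

end PartialSurjection

end EnumerationLocale

theorem mainTheorem11 {X H : Locale.{u}} (p : X ⟶ H) (hp : Locale.IsLocalHomeo p) :
    ∃ (P : Locale.{u}) (q : P ⟶ H), Locale.IsOpenSurjection q ∧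
      ∃ e : ∀ U : Locale.{u}, (U ⟶ P) ≃ Locale.FibrePartialSurjection p U,
        (∀ (U : Locale.{u}) (t : U ⟶ P), (e U t).point = t ≫ q) ∧
        (∀ (U V : Locale.{u}) (g : V ⟶ U) (t : U ⟶ P),
          Locale.FibrePartialSurjection.IsRestriction g (e U t) (e V (g ≫ t))) := by
  open EnumerationLocale in
  refine ⟨enumerationLocale ℕ p, enumerationBase ℕ p, isOpenSurjection_enumerationBase hp.1,
    fun U => (pointEquiv hp.1 U).trans (graphEquiv hp U), fun U t => rfl, fun U V g t => ?_⟩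
  have base : (g ≫ t) ≫ enumerationBase ℕ p = g ≫ t ≫ enumerationBase ℕ p := Category.assoc ..
  exact ⟨base, fun n =>
    (inv_fibreMap_ofIncidence g base fun u => Locale.inv t (genericIncidence p n u)).symm⟩
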